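/- For $m\in\mathbb{N}$ write $(a;q)_m=\prod_{j=0}^{m-1}(1-aq^j)$, $(a;q)_\infty=\prod_{j\ge 0}(1-aq^j)$ and $(a_1,a_2,a_3;q)_\infty=(a_1;q)_\infty(a_2;q)_\infty(a_3;q)_\infty$. For every complex number $q$ with $|q|<1$ the following double series is summable and $$\sum_{n,r\ge 0}\frac{q^{2n^2+4nr+3r^2+6n+9r}\,(q^3;q^3)_r}{(-q;q)_{2n+2r+3}\,(q;q)_{2r+2}\,(q;q)_r\,(q^2;q^2)_n}=\frac{(q^3,q^{60},q^{63};q^{63})_\infty}{(q^2;q^2)_\infty}.$$ The same identity holds between formal power series in an indeterminate $q$ with integer coefficients, where the sum and the infinite products converge coefficientwise (each coefficient is eventually constant). -/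

import Mathlib

open scoped PowerSeries.WithPiTopology

/-- The finite `q`-shifted factorial `(a; q)_m = ∏_{j=0}^{m-1} (1 - a q^j)`. -/
def qPoch {R : Type*} [CommRing R] (a q : R) (m : ℕ) : R :=
  ∏ j ∈ Finset.range m, (1 - a * q ^ j)

/-- The infinite `q`-shifted factorial `(a; q)_∞ = ∏_{j=0}^{∞} (1 - a q^j)`. -/
noncomputable def qPochInf {R : Type*} [CommRing R] [TopologicalSpace R] (a q : R) : R :=
  ∏' j : ℕ, (1 - a * q ^ j)

/-- For complex `|q| < 1` the product defining `(a; q)_∞` converges. -/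
theorem multipliable_qPochInf_complex (a : ℂ) {q : ℂ} (hq : ‖q‖ < 1) :
    Multipliable (fun j : ℕ => 1 - a * q ^ j) := by
  have h : Summable (fun j : ℕ => ‖-(a * q ^ j)‖) := by
    simp only [norm_neg, norm_mul, norm_pow]
    exact (summable_geometric_of_lt_one (norm_nonneg q) hq).mul_left _
  simpa [sub_eq_add_neg] using multipliable_one_add_of_summable h

/-- The numerator of the `(n, r)` term:
`q^(2n² + 4nr + 3r² + 6n + 9r) (q³; q³)_r`. -/
def termNum {R : Type*} [CommRing R] (q : R) (n r : ℕ) : R :=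
  q ^ (2 * n ^ 2 + 4 * n * r + 3 * r ^ 2 + 6 * n + 9 * r) * qPoch (q ^ 3) (q ^ 3) r

/-- The denominator of the `(n, r)` term:
`(-q; q)_{2n+2r+3} (q; q)_{2r+2} (q; q)_r (q²; q²)_n`. -/
def termDen {R : Type*} [CommRing R] (q : R) (n r : ℕ) : R :=
  qPoch (-q) q (2 * n + 2 * r + 3) * qPoch q q (2 * r + 2) * qPoch q q r
    * qPoch (q ^ 2) (q ^ 2) n

/-- For complex `|q| < 1` no denominator vanishes. -/
theorem termDen_ne_zero {q : ℂ} (hq : ‖q‖ < 1) (n r : ℕ) : termDen q n r ≠ 0 := by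
  have key : ∀ (a p : ℂ) (m : ℕ), ‖a‖ < 1 → ‖p‖ < 1 → qPoch a p m ≠ 0 := by
    intro a p m ha hp
    refine Finset.prod_ne_zero_iff.mpr fun j _ h => ?_
    have h1 : ‖a * p ^ j‖ < 1 := by
      rw [norm_mul, norm_pow]
      exact lt_of_le_of_lt
        (mul_le_of_le_one_right (norm_nonneg a) (pow_le_one₀ (norm_nonneg p) hp.le)) ha
    rw [← sub_eq_zero.mp h, norm_one] at h1
    exact lt_irrefl _ h1
  have hq2 : ‖q ^ 2‖ < 1 := by
    rw [norm_pow]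
    exact pow_lt_one₀ (norm_nonneg q) hq two_ne_zero
  exact mul_ne_zero (mul_ne_zero (mul_ne_zero (key _ _ _ (by simpa using hq) hq)
    (key _ _ _ hq hq)) (key _ _ _ hq hq)) (key _ _ _ hq2 hq2)

/-- The indeterminate `q` of the ring `ℤ⟦q⟧` of formal power series. -/
noncomputable abbrev qvar : PowerSeries ℤ := PowerSeries.X

/-- In `ℤ⟦X⟧` every denominator is invertible, so `Ring.inverse` is a true inverse there. -/
theorem isUnit_termDen (n r : ℕ) : IsUnit (termDen qvar n r) := by
  rw [PowerSeries.isUnit_iff_constantCoeff]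
  simp [termDen, qPoch, map_prod]

/-- In `ℤ⟦X⟧` (discrete topology on the coefficients) the product defining
`(q^i; q^k)_∞` at `q = X` converges for `k > 0`. -/
theorem multipliable_qPochInf_formal (i : ℕ) {k : ℕ} (hk : 0 < k) :
    Multipliable (fun j : ℕ =>
      1 - (PowerSeries.X : PowerSeries ℤ) ^ i * (PowerSeries.X ^ k) ^ j) := by
  have h : Filter.Tendsto
      (fun j : ℕ => (-((PowerSeries.X : PowerSeries ℤ) ^ (i + k * j))).order)
      Filter.atTop (nhds ⊤) := by
    simp only [PowerSeries.order_neg, PowerSeries.order_X_pow]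
    refine ENat.tendsto_nhds_top_iff_natCast_lt.mpr fun n => ?_
    filter_upwards [Filter.eventually_gt_atTop n] with j hj
    exact_mod_cast (by nlinarith : n < i + k * j)
  have h2 := PowerSeries.WithPiTopology.multipliable_one_add_of_tendsto_order_atTop_nhds_top ℤ h
  simpa [sub_eq_add_neg, pow_add, pow_mul] using h2

/-- The formal infinite product `(q²; q²)_∞` is invertible in `ℤ⟦X⟧`. -/
theorem isUnit_qPochInf_formal :
    IsUnit (qPochInf (qvar ^ 2) (qvar ^ 2)) := by
  rw [PowerSeries.isUnit_iff_constantCoeff, qPochInf,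
    (multipliable_qPochInf_formal 2 two_pos).map_tprod _
      (PowerSeries.WithPiTopology.continuous_constantCoeff ℤ)]
  simp

/-! ### Finite sums: `q`-binomial, `q`-Vandermonde and base change, all by one recurrence -/

section Finite

variable {F : Type*} [Field F]

/-! The identity comes from a Bailey chain relative to `a = q^3`. Sequences `α`, `β` form a pair if
`β_r = ∑_j α_j / ((q;q)_{r-j} (q;q)_{r+j+3})`. The starting pair has `β_r = (q^3;q^3)_r / ((q;q)_r
(q;q)_{2r+2})` and `α` supported on multiples of 3 (`cubic_bailey_pair`). It is the finite Jacobi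
triple product averaged over `z = ζ/q` with `ζ^3 = 1`.

Two moves follow. `bailey_base_change` passes from base `q` to `q^2` and multiplies `α_j` by
`q^(j^2+3j)`; `bailey_finite` in base `q^2` multiplies it by `q^(2(j^2+3j))`. With `k = n + r`, the
weights `2(k^2+3k) + (r^2+3r)` add up to the exponent of the double series, so `finite_double_sum`
is an exact identity for every cutoff `m`.

As `m → ∞` it says that the double series divided by `(q^2;q^2)_∞` equals `∑_j q^(3(j^2+3j)) α_j`
divided by `(q^2;q^2)_∞^2`. On `j = 3k` this theta series is the triple product in base `q^63` at `z
= q^3`, whence the numerator.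

Everything before the limit is algebra over a field. The limit is taken once, in
`hasSum_double_series`, for any topological ring with a suitable dominated convergence principle;
the complex and formal cases only supply its hypotheses. -/

theorem qPoch_zero {R : Type*} [CommRing R] (a q : R) : qPoch a q 0 = 1 := by
  simp [qPoch]

theorem qPoch_succ {R : Type*} [CommRing R] (a q : R) (m : ℕ) :
    qPoch a q (m + 1) = qPoch a q m * (1 - a * q ^ m) :=
  Finset.prod_range_succ _ _

theorem qPoch_add {R : Type*} [CommRing R] (a q : R) (m n : ℕ) :
    qPoch a q (m + n) = qPoch a q m * qPoch (a * q ^ m) q n := by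
  simp only [qPoch, Finset.prod_range_add, pow_add, mul_assoc]

theorem qPoch_self_ne_zero {q : F} (hq : ∀ n : ℕ, q ^ (n + 1) ≠ 1) (m : ℕ) :
    qPoch q q m ≠ 0 := by
  refine Finset.prod_ne_zero_iff.mpr fun j _ h => hq j ?_
  rw [pow_succ']
  exact (sub_eq_zero.mp h).symm

theorem one_sub_pow_succ_ne_zero {q : F} (hq : ∀ n : ℕ, q ^ (n + 1) ≠ 1) (m : ℕ) :
    1 - q * q ^ m ≠ 0 := by
  rw [← pow_succ']
  exact fun h => hq m (sub_eq_zero.mp h).symm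

theorem pow_pow_succ_ne_one {q : F} (hq : ∀ n : ℕ, q ^ (n + 1) ≠ 1) {d : ℕ} (hd : 0 < d)
    (n : ℕ) : (q ^ d) ^ (n + 1) ≠ 1 := by
  obtain ⟨e, rfl⟩ := Nat.exists_eq_succ_of_ne_zero hd.ne'
  rw [← pow_mul, show e.succ * (n + 1) = (e * n + e + n) + 1 by simp; ring]
  exact hq _

theorem mul_div_mul_self_cancel {d : F} (hd : d ≠ 0) (x y : F) : d * (x / (y * d)) = x / y := by
  rw [mul_div_assoc', mul_comm d, mul_div_mul_right _ _ hd]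

/-- The convolution of `u` with the sequence `1 / (p; p)_j`. -/
def qConv (p : F) (u : ℕ → F) (n : ℕ) : F :=
  ∑ x ∈ Finset.HasAntidiagonal.antidiagonal n, u x.1 / qPoch p p x.2

/-- The engine for the three summations below: each is proved by induction on `n`, once `v` is
expressed through sequences of the same family. -/
theorem qConv_succ {p : F} (hp : ∀ n : ℕ, p ^ (n + 1) ≠ 1) {u v : ℕ → F}
    (huv : ∀ t, (1 - p * p ^ t) * u (t + 1) = p ^ t * v t) (n : ℕ) :
    (1 - p * p ^ n) * qConv p u (n + 1) = qConv p u n + p ^ n * qConv p v n := by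
  -- For `i + j = n + 1`, `1 - p^(n+1) = (1 - p^j) + p^j (1 - p^i)`. The first part lowers `j`, the
  -- second lowers `i`.
  have h1 : (1 - p * p ^ n) * qConv p u (n + 1)
      = ∑ x ∈ Finset.HasAntidiagonal.antidiagonal (n + 1), (1 - p ^ x.2) * (u x.1 / qPoch p p x.2)
        + ∑ x ∈ Finset.HasAntidiagonal.antidiagonal (n + 1),
            p ^ x.2 * ((1 - p ^ x.1) * u x.1 / qPoch p p x.2) := by
    rw [qConv, Finset.mul_sum, ← Finset.sum_add_distrib]
    refine Finset.sum_congr rfl fun x hx => ?_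
    rw [← pow_succ', ← Finset.HasAntidiagonal.mem_antidiagonal.mp hx, pow_add]
    ring
  rw [h1, Finset.Nat.sum_antidiagonal_succ', Finset.Nat.sum_antidiagonal_succ, qConv, qConv,
    Finset.mul_sum]
  simp only [pow_zero, sub_self, zero_mul, zero_div, mul_zero, zero_add]
  congr 1
  · refine Finset.sum_congr rfl fun x _ => ?_
    have h2 := one_sub_pow_succ_ne_zero hp x.2
    have h3 := qPoch_self_ne_zero hp x.2
    rw [qPoch_succ, pow_succ']
    field_simp
  · refine Finset.sum_congr rfl fun x hx => ?_
    rw [pow_succ', huv, ← Finset.HasAntidiagonal.mem_antidiagonal.mp hx, pow_add]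
    ring

theorem qConv_zero (p : F) (u : ℕ → F) : qConv p u 0 = u 0 := by
  simp [qConv, qPoch_zero]

theorem qConv_mul_left (p a : F) (u : ℕ → F) (n : ℕ) :
    qConv p (fun i => a * u i) n = a * qConv p u n := by
  simp only [qConv, Finset.mul_sum, mul_div_assoc]

theorem qConv_add (p : F) (u v : ℕ → F) (n : ℕ) :
    qConv p (fun i => u i + v i) n = qConv p u n + qConv p v n := by
  simp only [qConv, ← Finset.sum_add_distrib, add_div]

/-- The finite `q`-binomial theorem. -/
theorem qConv_binomial {p : F} (hp : ∀ n : ℕ, p ^ (n + 1) ≠ 1) (x : F) (n : ℕ) :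
    qConv p (fun i => (-1) ^ i * p ^ (i.choose 2) * x ^ i / qPoch p p i) n
      = qPoch x p n / qPoch p p n := by
  induction n with
  | zero => simp [qConv_zero, qPoch_zero]
  | succ n ih =>
    have h2 := one_sub_pow_succ_ne_zero hp n
    have h3 := qPoch_self_ne_zero hp n
    have h := qConv_succ hp (u := fun i => (-1) ^ i * p ^ (i.choose 2) * x ^ i / qPoch p p i)
      (v := fun i => -x * ((-1) ^ i * p ^ (i.choose 2) * x ^ i / qPoch p p i)) (fun t => by
        have h2 := one_sub_pow_succ_ne_zero hp t
        have h3 := qPoch_self_ne_zero hp t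
        simp only [qPoch_succ, Nat.choose_succ_succ' t 1, Nat.choose_one_right, pow_add, pow_succ]
        field_simp) n
    rw [qConv_mul_left, ih] at h
    apply mul_left_cancel₀ h2
    rw [h, qPoch_succ, qPoch_succ, mul_div_mul_self_cancel h2]
    ring

/-- A limiting case of the `q`-Chu-Vandermonde sum. -/
theorem qConv_vandermonde {p : F} (hp : ∀ n : ℕ, p ^ (n + 1) ≠ 1) (n c : ℕ) :
    qConv p (fun s => p ^ (s ^ 2 + c * s) / (qPoch p p s * qPoch p p (s + c))) n
      = 1 / (qPoch p p n * qPoch p p (n + c)) := by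
  induction n generalizing c with
  | zero => simp [qConv_zero, qPoch_zero]
  | succ n ih =>
    have h2 := one_sub_pow_succ_ne_zero hp n
    have h := qConv_succ hp
      (u := fun s => p ^ (s ^ 2 + c * s) / (qPoch p p s * qPoch p p (s + c)))
      (v := fun s => p ^ (c + 1) *
        (p ^ (s ^ 2 + (c + 1) * s) / (qPoch p p s * qPoch p p (s + (c + 1))))) (fun t => by
        have h2 := one_sub_pow_succ_ne_zero hp t
        have h3 := qPoch_self_ne_zero hp t
        have h4 := qPoch_self_ne_zero hp (t + c + 1)
        rw [qPoch_succ, show t + 1 + c = t + c + 1 by ring, ← add_assoc]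
        field_simp
        ring) n
    rw [qConv_mul_left, ih, ih] at h
    apply mul_left_cancel₀ h2
    have h3 := qPoch_self_ne_zero hp n
    have h4 := qPoch_self_ne_zero hp (n + c)
    have h5 := one_sub_pow_succ_ne_zero hp (n + c)
    rw [h, qPoch_succ, show n + 1 + c = n + c + 1 by ring, ← add_assoc, qPoch_succ,
      mul_right_comm _ (1 - p * p ^ n), mul_div_mul_self_cancel h2]
    obtain ⟨e, he⟩ : ∃ e, e = 1 - p * p ^ (n + c) := ⟨_, rfl⟩
    rw [← he] at h5 ⊢
    clear h
    field_simp
    linear_combination he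

/-- A `q`-Vandermonde type sum that changes the base from `q` to `q ^ 2`. -/
theorem qConv_base_change {q : F} (hq : ∀ n : ℕ, q ^ (n + 1) ≠ 1) (n c : ℕ) :
    qConv (q ^ 2) (fun s => q ^ (s ^ 2 + c * s) / (qPoch q q s * qPoch q q (s + c))) n
      = qPoch (-q) q (2 * n + c) /
        (qPoch (q ^ 2) (q ^ 2) n * qPoch (q ^ 2) (q ^ 2) (n + c)) := by
  have hp := pow_pow_succ_ne_one hq two_pos
  have key : ∀ m, qPoch (q ^ 2) (q ^ 2) m = qPoch q q m * qPoch (-q) q m := fun m => by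
    simp only [qPoch, ← Finset.prod_mul_distrib]
    exact Finset.prod_congr rfl fun j _ => by ring
  induction n generalizing c with
  | zero =>
    have h := qPoch_self_ne_zero hp c
    rw [key] at h
    simp only [qConv_zero, qPoch_zero, key, zero_add, mul_zero]
    have := left_ne_zero_of_mul h
    have := right_ne_zero_of_mul h
    field_simp
    simp
  | succ n ih =>
    have h2 := one_sub_pow_succ_ne_zero hp n
    -- The splitting `1 + q^(t+1) = (1 - q^(t+c+1)) + q^t (q + q^(c+1))` writes `v` through the
    -- summands with parameters `c` and `c + 1`, so both induction hypotheses apply.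
    have h := qConv_succ hp
      (u := fun s => q ^ (s ^ 2 + c * s) / (qPoch q q s * qPoch q q (s + c)))
      (v := fun s => q ^ (c + 1) * (q ^ (s ^ 2 + c * s) / (qPoch q q s * qPoch q q (s + c)))
        + q ^ (c + 1) * (q + q ^ (c + 1)) *
        (q ^ (s ^ 2 + (c + 1) * s) / (qPoch q q s * qPoch q q (s + (c + 1))))) (fun t => by
        have h2 := one_sub_pow_succ_ne_zero hq t
        have h3 := qPoch_self_ne_zero hq t
        have h4 := qPoch_self_ne_zero hq (t + c)
        have h5 := one_sub_pow_succ_ne_zero hq (t + c)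
        rw [qPoch_succ, show t + 1 + c = t + c + 1 by ring, ← add_assoc, qPoch_succ]
        field_simp
        ring) n
    rw [qConv_add, qConv_mul_left, qConv_mul_left, ih, ih] at h
    apply mul_left_cancel₀ h2
    have h3 := qPoch_self_ne_zero hp n
    have h4 := qPoch_self_ne_zero hp (n + c)
    have h5 := one_sub_pow_succ_ne_zero hp (n + c)
    rw [h, qPoch_succ, show n + 1 + c = n + c + 1 by ring, ← add_assoc n, qPoch_succ,
      show 2 * (n + 1) + c = 2 * n + c + 1 + 1 by ring, qPoch_succ (-q),
      qPoch_succ (-q), mul_right_comm _ (1 - q ^ 2 * (q ^ 2) ^ n), mul_div_mul_self_cancel h2,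
      ← add_assoc (2 * n), qPoch_succ (-q)]
    obtain ⟨e, he⟩ : ∃ e, e = 1 - q ^ 2 * (q ^ 2) ^ (n + c) := ⟨_, rfl⟩
    rw [← he] at h5 ⊢
    clear h
    field_simp
    linear_combination qPoch (-q) q (2 * n + c) * (1 + q * q ^ (2 * n) * q ^ c) * he

end Finite

/-! ### Finite Jacobi triple product -/

section TripleProduct

variable {F : Type*} [Field F]

/-- Two indices with odd sum differ by an odd number `2k + 1`; pairing each index pair with its
mirror image produces the two halves of a theta term. -/
theorem sum_antidiagonal_odd {M : Type*} [AddCommMonoid M] (f : ℕ → ℕ → M) (m : ℕ) :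
    ∑ x ∈ Finset.HasAntidiagonal.antidiagonal (2 * m + 1), f x.1 x.2
      = ∑ x ∈ Finset.HasAntidiagonal.antidiagonal m,
          (f x.2 (x.2 + 2 * x.1 + 1) + f (x.2 + 2 * x.1 + 1) x.2) := by
  rw [Finset.sum_add_distrib, Finset.Nat.sum_antidiagonal_eq_sum_range_succ f,
    show (2 * m + 1).succ = (m + 1) + (m + 1) by simp; ring, Finset.sum_range_add]
  congr 1
  · rw [← Finset.Nat.sum_antidiagonal_swap]
    simp only [Prod.fst_swap, Prod.snd_swap]
    rw [Finset.Nat.sum_antidiagonal_eq_sum_range_succ (fun i j => f i (i + 2 * j + 1))]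
    refine Finset.sum_congr rfl fun i hi => ?_
    have := Finset.mem_range.mp hi
    congr 1
    omega
  · rw [Finset.Nat.sum_antidiagonal_eq_sum_range_succ (fun i j => f (j + 2 * i + 1) j)]
    refine Finset.sum_congr rfl fun i hi => ?_
    have := Finset.mem_range.mp hi
    congr 1 <;> omega

theorem choose_two_identity (k t : ℕ) :
    t.choose 2 + (k + t + 1).choose 2 = (k + 1).choose 2 + (k + t) * t := by
  induction t with
  | zero => simp
  | succ t ih =>
    have h1 := Nat.choose_succ_succ' t 1
    have h2 := Nat.choose_succ_succ' (k + t + 1) 1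
    simp only [Nat.choose_one_right] at h1 h2
    rw [← add_assoc k, h1, h2]
    linarith

theorem choose_two_identity' (k t : ℕ) :
    (t + 2 * k + 1).choose 2 + (k + t + 1).choose 2
      = (k + 1).choose 2 + (k + t) * (t + 2 * k + 1) := by
  induction t with
  | zero =>
    induction k with
    | zero => simp
    | succ k ih =>
      have h1 := Nat.choose_succ_succ' (2 * k + 1 + 1) 1
      have h2 := Nat.choose_succ_succ' (2 * k + 1) 1
      have h3 := Nat.choose_succ_succ' (k + 1) 1
      simp only [Nat.choose_one_right] at h1 h2 h3
      rw [show 0 + 2 * (k + 1) + 1 = 2 * k + 1 + 1 + 1 by ring, add_zero, h1, h2, h3]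
      simp only [zero_add, add_zero] at ih
      linarith
  | succ t ih =>
    have h1 := Nat.choose_succ_succ' (t + 2 * k + 1) 1
    have h2 := Nat.choose_succ_succ' (k + t + 1) 1
    simp only [Nat.choose_one_right] at h1 h2
    rw [← add_assoc k, show t + 1 + 2 * k + 1 = t + 2 * k + 1 + 1 by ring, h1, h2]
    linarith

/-- Reflection: `1 - z/q^i = -(z/q^i)(1 - q^i/z)` for each of the `m` factors. -/
theorem qPoch_div_pow {q z : F} (hq : q ≠ 0) (hz : z ≠ 0) (m : ℕ) :
    qPoch (z / q ^ m) q m * q ^ ((m + 1).choose 2) = (-z) ^ m * qPoch (q / z) q m := by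
  induction m with
  | zero => simp [qPoch_zero]
  | succ m ih =>
    have h : qPoch (z / q ^ (m + 1)) q (m + 1)
        = (1 - z / q ^ (m + 1)) * qPoch (z / q ^ m) q m := by
      rw [add_comm m 1, qPoch_add, pow_one, add_comm 1 m,
        show z / q ^ (m + 1) * q = z / q ^ m by rw [pow_succ]; field_simp]
      simp [qPoch]
    rw [h, Nat.choose_succ_succ' (m + 1) 1, Nat.choose_one_right, pow_add q (m + 1), qPoch_succ (q / z),
      show ∀ a b c d : F, a * b * (c * d) = (b * d) * (a * c) by intros; ring, ih]
    field_simp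
    ring

/-- The finite form of Jacobi's triple product identity. -/
theorem finite_triple_product {q z : F} (hq : ∀ n : ℕ, q ^ (n + 1) ≠ 1) (hq0 : q ≠ 0)
    (hz : z ≠ 0) (m : ℕ) :
    qPoch z q (m + 1) * qPoch (q / z) q m
      = qPoch q q (2 * m + 1) * ∑ x ∈ Finset.HasAntidiagonal.antidiagonal m,
          (-1) ^ x.1 * q ^ ((x.1 + 1).choose 2) * (z⁻¹ ^ x.1 - z ^ (x.1 + 1)) /
            (qPoch q q x.2 * qPoch q q (x.2 + 2 * x.1 + 1)) := by
  -- Starting at `z / q^m` centres the product: its first `m` factors reflect to `(q/z;q)_m`, and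
  -- the other `m + 1` are `(z;q)_{m+1}`.
  have h := qConv_binomial hq (z / q ^ m) (2 * m + 1)
  rw [qConv, sum_antidiagonal_odd (fun i j => (-1) ^ i * q ^ (i.choose 2) * (z / q ^ m) ^ i /
    qPoch q q i / qPoch q q j), eq_div_iff (qPoch_self_ne_zero hq _),
    show 2 * m + 1 = m + (m + 1) by ring, qPoch_add (z / q ^ m), div_mul_cancel₀ _ (pow_ne_zero _ hq0)] at h
  have h1 := qPoch_div_pow hq0 hz m
  have h2 : (-z) ^ m ≠ 0 := pow_ne_zero _ (neg_ne_zero.mpr hz)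
  apply mul_left_cancel₀ h2
  suffices key : q ^ ((m + 1).choose 2) * ∑ x ∈ Finset.HasAntidiagonal.antidiagonal m,
      ((-1) ^ x.2 * q ^ (x.2.choose 2) * (z / q ^ m) ^ x.2 / qPoch q q x.2 /
          qPoch q q (x.2 + 2 * x.1 + 1) +
        (-1) ^ (x.2 + 2 * x.1 + 1) * q ^ ((x.2 + 2 * x.1 + 1).choose 2) *
          (z / q ^ m) ^ (x.2 + 2 * x.1 + 1) / qPoch q q (x.2 + 2 * x.1 + 1) / qPoch q q x.2)
      = (-z) ^ m * ∑ x ∈ Finset.HasAntidiagonal.antidiagonal m,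
          (-1) ^ x.1 * q ^ ((x.1 + 1).choose 2) * (z⁻¹ ^ x.1 - z ^ (x.1 + 1)) /
            (qPoch q q x.2 * qPoch q q (x.2 + 2 * x.1 + 1)) by
    rw [show 2 * m + 1 = m + (m + 1) by ring]
    linear_combination -qPoch z q (m + 1) * h1 - q ^ ((m + 1).choose 2) * h +
      qPoch q q (m + (m + 1)) * key
  rw [Finset.mul_sum, Finset.mul_sum]
  refine Finset.sum_congr rfl fun x hx => ?_
  obtain ⟨k, t⟩ := x
  obtain rfl : k + t = m := Finset.HasAntidiagonal.mem_antidiagonal.mp hx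
  have e1 := congrArg (q ^ ·) (choose_two_identity k t)
  have e2 := congrArg (q ^ ·) (choose_two_identity' k t)
  simp only [pow_add _ (Nat.choose _ _), pow_mul] at e1 e2
  have h3 := qPoch_self_ne_zero hq t
  have h4 := qPoch_self_ne_zero hq (t + 2 * k + 1)
  have s1 : q ^ ((k + t + 1).choose 2) * ((-1) ^ t * q ^ (t.choose 2) * (z / q ^ (k + t)) ^ t)
      = (-z) ^ (k + t) * ((-1) ^ k * q ^ ((k + 1).choose 2) * z⁻¹ ^ k) := by
    have : q ^ ((k + t + 1).choose 2) * ((-1) ^ t * q ^ (t.choose 2) * (z / q ^ (k + t)) ^ t)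
      = (q ^ (t.choose 2) * q ^ ((k + t + 1).choose 2)) * ((-1) ^ t * (z / q ^ (k + t)) ^ t) := by
      ring
    rw [this, e1, div_pow]
    have h5 : (q ^ (k + t)) ^ t ≠ 0 := pow_ne_zero _ (pow_ne_zero _ hq0)
    have h6 : ((-1 : F) ^ k) ^ 2 = 1 := by rw [← pow_mul, mul_comm, pow_mul]; simp
    rw [neg_pow z, pow_add z, pow_add (-1 : F) k t, inv_pow]
    field_simp
    linear_combination -h6
  have s2 : q ^ ((k + t + 1).choose 2) * ((-1) ^ (t + 2 * k + 1) *
        q ^ ((t + 2 * k + 1).choose 2) * (z / q ^ (k + t)) ^ (t + 2 * k + 1))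
      = -((-z) ^ (k + t) * ((-1) ^ k * q ^ ((k + 1).choose 2) * z ^ (k + 1))) := by
    have : q ^ ((k + t + 1).choose 2) * ((-1) ^ (t + 2 * k + 1) *
        q ^ ((t + 2 * k + 1).choose 2) * (z / q ^ (k + t)) ^ (t + 2 * k + 1))
      = (q ^ ((t + 2 * k + 1).choose 2) * q ^ ((k + t + 1).choose 2)) *
        ((-1) ^ (t + 2 * k + 1) * (z / q ^ (k + t)) ^ (t + 2 * k + 1)) := by
      ring
    rw [this, e2, div_pow]
    have h5 : (q ^ (k + t)) ^ (t + 2 * k + 1) ≠ 0 := pow_ne_zero _ (pow_ne_zero _ hq0)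
    rw [mul_assoc, mul_left_comm ((q ^ (k + t)) ^ (t + 2 * k + 1)), mul_div_cancel₀ _ h5,
      neg_pow z]
    ring
  calc _ = q ^ ((k + t + 1).choose 2) * ((-1) ^ t * q ^ (t.choose 2) * (z / q ^ (k + t)) ^ t)
        / (qPoch q q t * qPoch q q (t + 2 * k + 1)) +
        q ^ ((k + t + 1).choose 2) * ((-1) ^ (t + 2 * k + 1) *
        q ^ ((t + 2 * k + 1).choose 2) * (z / q ^ (k + t)) ^ (t + 2 * k + 1))
        / (qPoch q q t * qPoch q q (t + 2 * k + 1)) := by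
          field_simp
    _ = _ := by
      rw [s1, s2]
      ring

end TripleProduct

/-! ### The cubic Bailey pair -/

section BaileyPair

variable {F : Type*} [Field F]

/-- The sequence `α_j` of the cubic Bailey pair relative to `q ^ 3`, up to a constant factor. -/
def cubicAlpha {R : Type*} [CommRing R] (q : R) (j : ℕ) : R :=
  if 3 ∣ j then (-1) ^ j * q ^ ((j + 1).choose 2) * (1 - q ^ (2 * j + 3)) else 0

/-- Roots-of-unity filter, the source of the support condition in `cubicAlpha`. -/
theorem sum_cube_roots {w : F} (hw : w ^ 2 + w + 1 = 0) (j : ℕ) :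
    1 + w ^ j + (w ^ 2) ^ j = if 3 ∣ j then 3 else 0 := by
  have h3 : w ^ 3 = 1 := by linear_combination (w - 1) * hw
  obtain ⟨a, b, hb, rfl⟩ : ∃ a b, b < 3 ∧ j = 3 * a + b :=
    ⟨j / 3, j % 3, Nat.mod_lt _ (by norm_num), (Nat.div_add_mod j 3).symm⟩
  have h : ∀ e, w ^ (3 * a + e) = w ^ e := fun e => by rw [pow_add, pow_mul, h3]; simp
  rw [← pow_mul, mul_comm 2, pow_mul, h]
  interval_cases b
  · simp; norm_num
  · rw [if_neg (by omega)]
    linear_combination hw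
  · rw [if_neg (by omega)]
    linear_combination hw + w * h3

/-- Isolates `(wq;q)_r (w²q;q)_r`, which is symmetric under `w ↔ w²`, so that the products at the
two primitive cube roots can be added. -/
theorem cube_root_product {q w : F} (hq0 : q ≠ 0) (hw : w ^ 2 + w + 1 = 0) (r : ℕ) :
    w * (qPoch (w / q) q (r + 2) * qPoch (q / (w / q)) q (r + 1))
      = q⁻¹ * (1 - w ^ 2) * (1 - w ^ 2 * q ^ (r + 1)) * (1 - w ^ 2 * q ^ (r + 2)) *
        (qPoch (w * q) q r * qPoch (w ^ 2 * q) q r) := by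
  have h3 : w ^ 3 = 1 := by linear_combination (w - 1) * hw
  have hw0 : w ≠ 0 := fun h => by simp [h] at h3
  have h1 : qPoch (w / q) q (r + 2) = (1 - w / q) * (1 - w) * qPoch (w * q) q r := by
    rw [add_comm, qPoch_add, show w / q * q ^ 2 = w * q by field_simp]
    simp only [qPoch, Finset.prod_range_succ, Finset.prod_range_zero]
    field_simp
  have h2 : (1 - w ^ 2 * q) * qPoch (q / (w / q)) q (r + 1)
      = qPoch (w ^ 2 * q) q r * (1 - w ^ 2 * q ^ (r + 1)) * (1 - w ^ 2 * q ^ (r + 2)) := by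
    have e : q / (w / q) = w ^ 2 * q * q ^ 1 := by
      field_simp
      linear_combination -h3
    have h := qPoch_add (w ^ 2 * q) q 1 (r + 1)
    rw [← e, add_comm, qPoch_succ, qPoch_succ] at h
    have h0 : qPoch (w ^ 2 * q) q 1 = 1 - w ^ 2 * q := by simp [qPoch]
    rw [← h0, ← h]
    ring
  have h4 : w * (1 - w / q) * (1 - w) = q⁻¹ * (1 - w ^ 2) * (1 - w ^ 2 * q) := by
    field_simp
    linear_combination (1 - q * w) * h3
  rw [h1]
  linear_combination qPoch (w * q) q r * qPoch (q / (w / q)) q (r + 1) * h4 +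
    q⁻¹ * (1 - w ^ 2) * qPoch (w * q) q r * h2

theorem qPoch_cube {q w : F} (hw : w ^ 2 + w + 1 = 0) (r : ℕ) :
    qPoch (q ^ 3) (q ^ 3) r = qPoch q q r * (qPoch (w * q) q r * qPoch (w ^ 2 * q) q r) := by
  have h3 : w ^ 3 = 1 := by linear_combination (w - 1) * hw
  simp only [qPoch, ← Finset.prod_mul_distrib]
  refine Finset.prod_congr rfl fun j _ => ?_
  generalize hx : q * q ^ j = x
  have e : q ^ 3 * (q ^ 3) ^ j = x ^ 3 := by rw [← hx]; ring
  simp only [mul_assoc, hx, e]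
  linear_combination (x - x ^ 2) * hw + (x ^ 3 - x ^ 2) * h3

/-- A Bailey pair relative to `q ^ 3` of cubic type. -/
theorem cubic_bailey_pair {q w : F} (hq : ∀ n : ℕ, q ^ (n + 1) ≠ 1) (hq0 : q ≠ 0)
    (hw : w ^ 2 + w + 1 = 0) (h30 : (3 : F) ≠ 0) (r : ℕ) :
    ∑ x ∈ Finset.HasAntidiagonal.antidiagonal r,
        cubicAlpha q x.1 / (qPoch q q x.2 * qPoch q q (x.2 + 2 * x.1 + 3))
      = qPoch (q ^ 3) (q ^ 3) r / (qPoch q q r * qPoch q q (2 * r + 2)) := by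
  have h3 : w ^ 3 = 1 := by linear_combination (w - 1) * hw
  have hw0 : w ≠ 0 := fun h => by simp [h] at h3
  have hw' : (w ^ 2) ^ 2 + w ^ 2 + 1 = 0 := by linear_combination hw + w * h3
  -- At `ζ = 1` the factor `1 - (1/q) q` kills the product side.
  have hA : qPoch (1 / q) q (r + 2) = 0 := by
    refine Finset.prod_eq_zero (i := 1) (by simp) ?_
    field_simp
    simp
  have t0 := finite_triple_product hq hq0 (z := 1 / q) (div_ne_zero (by simp) hq0) (r + 1)
  have t1 := finite_triple_product hq hq0 (z := w / q) (div_ne_zero (by simp [hw0]) hq0) (r + 1)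
  have t2 := finite_triple_product hq hq0 (z := w ^ 2 / q) (div_ne_zero (by simp [hw0]) hq0) (r + 1)
  have p1 := cube_root_product hq0 hw r
  have p2 := cube_root_product hq0 hw' r
  rw [show (w ^ 2) ^ 2 = w by linear_combination w * h3] at p2
  -- The weights `ζ` cancel the index-`0` term, since `∑ ζ = ∑ ζ^2 = 0`. After the shift to `j + 1`
  -- they leave `ζ^(-j)` and `ζ^(2j+4-1) = ζ^(2j+3)` up to relabelling the roots, so the filter
  -- keeps `3 ∣ j`.
  have hs : (1 : F) * (qPoch q q (2 * (r + 1) + 1) * ∑ x ∈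
        Finset.HasAntidiagonal.antidiagonal (r + 1),
          (-1) ^ x.1 * q ^ ((x.1 + 1).choose 2) * ((1 / q)⁻¹ ^ x.1 - (1 / q) ^ (x.1 + 1)) /
            (qPoch q q x.2 * qPoch q q (x.2 + 2 * x.1 + 1))) +
      w * (qPoch q q (2 * (r + 1) + 1) * ∑ x ∈
        Finset.HasAntidiagonal.antidiagonal (r + 1),
          (-1) ^ x.1 * q ^ ((x.1 + 1).choose 2) * ((w / q)⁻¹ ^ x.1 - (w / q) ^ (x.1 + 1)) /
            (qPoch q q x.2 * qPoch q q (x.2 + 2 * x.1 + 1))) +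
      w ^ 2 * (qPoch q q (2 * (r + 1) + 1) * ∑ x ∈
        Finset.HasAntidiagonal.antidiagonal (r + 1),
          (-1) ^ x.1 * q ^ ((x.1 + 1).choose 2) *
            ((w ^ 2 / q)⁻¹ ^ x.1 - (w ^ 2 / q) ^ (x.1 + 1)) /
            (qPoch q q x.2 * qPoch q q (x.2 + 2 * x.1 + 1)))
      = 3 * q⁻¹ * qPoch q q (2 * r + 3) * ∑ x ∈ Finset.HasAntidiagonal.antidiagonal r,
        cubicAlpha q x.1 / (qPoch q q x.2 * qPoch q q (x.2 + 2 * x.1 + 3)) := by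
    simp only [Finset.mul_sum, ← Finset.sum_add_distrib]
    rw [Finset.Nat.sum_antidiagonal_succ]
    refine Eq.trans (add_eq_right.mpr ?_) ?_
    · simp only [pow_zero, zero_add, pow_one]
      have e : (1 : F) + w + w ^ 2 = 0 := by linear_combination hw
      have e' : (1 : F) + w ^ 2 + w ^ 4 = 0 := by linear_combination hw + w * h3
      linear_combination ((qPoch q q (2 * (r + 1) + 1)) * (q ^ Nat.choose 1 2) /
        (qPoch q q (r + 1) * qPoch q q (r + 1 + 2 * 0 + 1))) * (e - q⁻¹ * e')
    · refine Finset.sum_congr rfl fun x _ => ?_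
      obtain ⟨j, s⟩ := x
      simp only
      rw [show s + 2 * (j + 1) + 1 = s + 2 * j + 3 by ring,
        show 2 * (r + 1) + 1 = 2 * r + 3 by ring]
      have c1 : q ^ ((j + 1 + 1).choose 2) = q ^ ((j + 1).choose 2) * q ^ (j + 1) := by
        rw [← pow_add, Nat.choose_succ_succ' (j + 1) 1, Nat.choose_one_right, add_comm]
      have c2 : (1 * ((1 / q)⁻¹ ^ (j + 1) - (1 / q) ^ (j + 1 + 1)) +
          w * ((w / q)⁻¹ ^ (j + 1) - (w / q) ^ (j + 1 + 1)) +
          w ^ 2 * ((w ^ 2 / q)⁻¹ ^ (j + 1) - (w ^ 2 / q) ^ (j + 1 + 1)))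
          = (if 3 ∣ j then 3 else 0) * (q ^ (j + 1) - q⁻¹ ^ (j + 2)) := by
        have f1 := sum_cube_roots hw j
        have f2 : (1 : F) + w⁻¹ ^ j + (w⁻¹ ^ 2) ^ j = if 3 ∣ j then 3 else 0 := by
          refine sum_cube_roots ?_ j
          field_simp
          linear_combination hw
        rw [mul_sub, mul_sub, mul_sub]
        have g1 : w * (w / q)⁻¹ ^ (j + 1) = w⁻¹ ^ j * q ^ (j + 1) := by
          rw [inv_div, div_eq_mul_inv, mul_pow, pow_succ w⁻¹]
          field_simp
        have g2 : w ^ 2 * (w ^ 2 / q)⁻¹ ^ (j + 1) = (w⁻¹ ^ 2) ^ j * q ^ (j + 1) := by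
          have h : w ^ 2 * w⁻¹ ^ 2 = 1 := by rw [← mul_pow, mul_inv_cancel₀ hw0, one_pow]
          rw [inv_div, div_eq_mul_inv, mul_pow, ← inv_pow, pow_succ (w⁻¹ ^ 2)]
          linear_combination q ^ (j + 1) * (w⁻¹ ^ 2) ^ j * h
        have g3 : w * (w / q) ^ (j + 1 + 1) = w ^ j * q⁻¹ ^ (j + 2) := by
          rw [div_eq_mul_inv, mul_pow]
          linear_combination w ^ j * q⁻¹ ^ (j + 2) * h3
        have g4 : w ^ 2 * (w ^ 2 / q) ^ (j + 1 + 1) = (w ^ 2) ^ j * q⁻¹ ^ (j + 2) := by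
          rw [div_eq_mul_inv, mul_pow]
          linear_combination (w ^ 2) ^ j * q⁻¹ ^ (j + 2) * (w ^ 3 + 1) * h3
        have g5 : (1 / q)⁻¹ = q := by simp
        rw [g1, g2, g3, g4, g5, one_div]
        linear_combination q ^ (j + 1) * f2 - q⁻¹ ^ (j + 2) * f1
      have c3 : q ^ (j + 1) * (q ^ (j + 1) - q⁻¹ ^ (j + 2)) = -q⁻¹ * (1 - q ^ (2 * j + 3)) := by
        rw [inv_pow]
        field_simp
        ring
      trans qPoch q q (2 * r + 3) * (-1) ^ (j + 1) * q ^ ((j + 1).choose 2) *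
        ((if 3 ∣ j then 3 else 0) * (q ^ (j + 1) * (q ^ (j + 1) - q⁻¹ ^ (j + 2)))) /
          (qPoch q q s * qPoch q q (s + 2 * j + 3))
      · rw [mul_left_comm (if 3 ∣ j then (3 : F) else 0), ← c2, c1]
        ring
      · rw [c3, cubicAlpha]
        split_ifs
        · ring
        · ring
  have hr := qPoch_self_ne_zero hq r
  have hr2 := qPoch_self_ne_zero hq (2 * r + 2)
  rw [← t0, ← t1, ← t2, hA, p1, p2, qPoch_succ q q (2 * r + 2)] at hs
  rw [eq_div_iff (mul_ne_zero hr hr2), qPoch_cube hw]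
  have h5 : 3 * q⁻¹ * (1 - q * q ^ (2 * r + 2)) ≠ 0 :=
    mul_ne_zero (mul_ne_zero h30 (inv_ne_zero hq0)) (one_sub_pow_succ_ne_zero hq _)
  apply mul_left_cancel₀ h5
  -- The scalar left after removing the common product is `3 (1 - q^(2r+3))`, which reduces
  -- `(q;q)_{2r+3}` to `(q;q)_{2r+2}`.
  have e : (1 - w ^ 2) * (1 - w ^ 2 * q ^ (r + 1)) * (1 - w ^ 2 * q ^ (r + 2)) +
      (1 - w) * (1 - w * q ^ (r + 1)) * (1 - w * q ^ (r + 2))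
      = 3 * (1 - q * q ^ (2 * r + 2)) := by
    have h6 : q * q ^ (2 * r + 2) = q ^ (r + 1) * q ^ (r + 2) := by ring
    rw [h6]
    generalize q ^ (r + 1) = x
    generalize q ^ (r + 2) = y
    linear_combination -hw + (x + y) * w * h3 + x * y * (hw + (w - w ^ 3 - 2) * h3)
  linear_combination -(qPoch q q r) * hs + q⁻¹ * qPoch q q r *
    (qPoch (w * q) q r * qPoch (w ^ 2 * q) q r) * e

end BaileyPair

/-! ### Bailey chain and the finite double sum -/

section FiniteIdentity

variable {F : Type*} [Field F]

theorem sum_antidiagonal_assoc {M : Type*} [AddCommMonoid M] (f : ℕ → ℕ → ℕ → M) (n : ℕ) :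
    ∑ x ∈ Finset.HasAntidiagonal.antidiagonal n,
      ∑ y ∈ Finset.HasAntidiagonal.antidiagonal x.1, f y.1 y.2 x.2
    = ∑ x ∈ Finset.HasAntidiagonal.antidiagonal n,
      ∑ y ∈ Finset.HasAntidiagonal.antidiagonal x.2, f x.1 y.1 y.2 := by
  rw [Finset.sum_sigma', Finset.sum_sigma']
  refine Finset.sum_nbij' (fun x => ⟨(x.2.1, x.2.2 + x.1.2), (x.2.2, x.1.2)⟩)
    (fun x => ⟨(x.1.1 + x.2.1, x.2.2), (x.1.1, x.2.1)⟩) ?_ ?_ ?_ ?_ ?_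
  · rintro ⟨⟨a, b⟩, ⟨c, d⟩⟩ h
    simp only [Finset.mem_sigma, Finset.HasAntidiagonal.mem_antidiagonal] at h ⊢
    exact ⟨by omega, trivial⟩
  · rintro ⟨⟨a, b⟩, ⟨c, d⟩⟩ h
    simp only [Finset.mem_sigma, Finset.HasAntidiagonal.mem_antidiagonal] at h ⊢
    exact ⟨by omega, trivial⟩
  · rintro ⟨⟨a, b⟩, ⟨c, d⟩⟩ h
    simp only [Finset.mem_sigma, Finset.HasAntidiagonal.mem_antidiagonal] at h ⊢
    obtain ⟨-, rfl⟩ := h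
    rfl
  · rintro ⟨⟨a, b⟩, ⟨c, d⟩⟩ h
    simp only [Finset.mem_sigma, Finset.HasAntidiagonal.mem_antidiagonal] at h ⊢
    obtain ⟨-, rfl⟩ := h
    rfl
  · intro x _
    rfl

theorem qConv_sum_antidiagonal (p : F) (g : ℕ → ℕ → F) (n : ℕ) :
    qConv p (fun r => ∑ y ∈ Finset.HasAntidiagonal.antidiagonal r, g y.1 y.2) n
      = ∑ x ∈ Finset.HasAntidiagonal.antidiagonal n, qConv p (g x.1) x.2 := by
  simp only [qConv, Finset.sum_div]
  exact sum_antidiagonal_assoc (fun a b c => g a b / qPoch p p c) n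

theorem qPoch_neg_ne_zero {q : F} (hq : ∀ n : ℕ, q ^ (n + 1) ≠ 1) (m : ℕ) :
    qPoch (-q) q m ≠ 0 := by
  refine Finset.prod_ne_zero_iff.mpr fun j _ h => pow_pow_succ_ne_one hq two_pos j ?_
  linear_combination (-1 + q * q ^ j) * h

/-- The change of base from `q` to `q ^ 2` in the Bailey lemma, relative to `q ^ 3`. -/
theorem bailey_base_change {q : F} (hq : ∀ n : ℕ, q ^ (n + 1) ≠ 1) (α : ℕ → F) (n : ℕ) :
    qConv (q ^ 2) (fun r => q ^ (r ^ 2 + 3 * r) *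
        ∑ y ∈ Finset.HasAntidiagonal.antidiagonal r,
          α y.1 / (qPoch q q y.2 * qPoch q q (y.2 + 2 * y.1 + 3))) n
      = qPoch (-q) q (2 * n + 3) * ∑ y ∈ Finset.HasAntidiagonal.antidiagonal n,
          q ^ (y.1 ^ 2 + 3 * y.1) * α y.1 /
            (qPoch (q ^ 2) (q ^ 2) y.2 * qPoch (q ^ 2) (q ^ 2) (y.2 + 2 * y.1 + 3)) := by
  -- With `r = j + s`, `r^2 + 3r = (j^2 + 3j) + (s^2 + (2j+3)s)`; the sum over `s` is then
  -- `qConv_base_change` at `c = 2j + 3`.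
  have h : (fun r => q ^ (r ^ 2 + 3 * r) * ∑ y ∈ Finset.HasAntidiagonal.antidiagonal r,
          α y.1 / (qPoch q q y.2 * qPoch q q (y.2 + 2 * y.1 + 3)))
      = fun r => ∑ y ∈ Finset.HasAntidiagonal.antidiagonal r,
          q ^ (y.1 ^ 2 + 3 * y.1) * α y.1 * (q ^ (y.2 ^ 2 + (2 * y.1 + 3) * y.2) /
            (qPoch q q y.2 * qPoch q q (y.2 + (2 * y.1 + 3)))) := by
    funext r
    rw [Finset.mul_sum]
    refine Finset.sum_congr rfl fun y hy => ?_
    rw [← Finset.HasAntidiagonal.mem_antidiagonal.mp hy, add_assoc y.2]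
    ring
  rw [h, qConv_sum_antidiagonal (q ^ 2) (fun j s => q ^ (j ^ 2 + 3 * j) * α j *
    (q ^ (s ^ 2 + (2 * j + 3) * s) / (qPoch q q s * qPoch q q (s + (2 * j + 3))))), Finset.mul_sum]
  refine Finset.sum_congr rfl fun y hy => ?_
  rw [qConv_mul_left, qConv_base_change hq, ← Finset.HasAntidiagonal.mem_antidiagonal.mp hy,
    add_assoc y.2, show 2 * y.2 + (2 * y.1 + 3) = 2 * (y.1 + y.2) + 3 by ring]
  ring

/-- A finite form of the Bailey lemma relative to `p ^ 3`. -/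
theorem bailey_finite {p : F} (hp : ∀ n : ℕ, p ^ (n + 1) ≠ 1) (α : ℕ → F) (n : ℕ) :
    qConv p (fun r => p ^ (r ^ 2 + 3 * r) *
        ∑ y ∈ Finset.HasAntidiagonal.antidiagonal r,
          α y.1 / (qPoch p p y.2 * qPoch p p (y.2 + 2 * y.1 + 3))) n
      = ∑ y ∈ Finset.HasAntidiagonal.antidiagonal n,
          p ^ (y.1 ^ 2 + 3 * y.1) * α y.1 /
            (qPoch p p y.2 * qPoch p p (y.2 + 2 * y.1 + 3)) := by
  have h : (fun r => p ^ (r ^ 2 + 3 * r) * ∑ y ∈ Finset.HasAntidiagonal.antidiagonal r,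
          α y.1 / (qPoch p p y.2 * qPoch p p (y.2 + 2 * y.1 + 3)))
      = fun r => ∑ y ∈ Finset.HasAntidiagonal.antidiagonal r,
          p ^ (y.1 ^ 2 + 3 * y.1) * α y.1 * (p ^ (y.2 ^ 2 + (2 * y.1 + 3) * y.2) /
            (qPoch p p y.2 * qPoch p p (y.2 + (2 * y.1 + 3)))) := by
    funext r
    rw [Finset.mul_sum]
    refine Finset.sum_congr rfl fun y hy => ?_
    rw [← Finset.HasAntidiagonal.mem_antidiagonal.mp hy, add_assoc y.2]
    ring
  rw [h, qConv_sum_antidiagonal p (fun j s => p ^ (j ^ 2 + 3 * j) * α j *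
    (p ^ (s ^ 2 + (2 * j + 3) * s) / (qPoch p p s * qPoch p p (s + (2 * j + 3)))))]
  refine Finset.sum_congr rfl fun y _ => ?_
  rw [qConv_mul_left, qConv_vandermonde hp, add_assoc y.2]
  ring

/-- The finite form of the double series identity. -/
theorem finite_double_sum {q w : F} (hq : ∀ n : ℕ, q ^ (n + 1) ≠ 1) (hq0 : q ≠ 0)
    (hw : w ^ 2 + w + 1 = 0) (h30 : (3 : F) ≠ 0) (m : ℕ) :
    qConv (q ^ 2) (fun k => ∑ x ∈ Finset.HasAntidiagonal.antidiagonal k,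
        termNum q x.1 x.2 / termDen q x.1 x.2) m
      = ∑ x ∈ Finset.HasAntidiagonal.antidiagonal m,
          q ^ (3 * (x.1 ^ 2 + 3 * x.1)) * cubicAlpha q x.1 /
            (qPoch (q ^ 2) (q ^ 2) x.2 * qPoch (q ^ 2) (q ^ 2) (x.2 + 2 * x.1 + 3)) := by
  have hp := pow_pow_succ_ne_one hq two_pos
  -- The terms with `n + r = k` share `(-q;q)_{2k+3}`; dividing the base change by it gives the `β`
  -- of a pair in base `q^2`.
  have h : (fun k => ∑ x ∈ Finset.HasAntidiagonal.antidiagonal k,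
        termNum q x.1 x.2 / termDen q x.1 x.2)
      = fun k => (q ^ 2) ^ (k ^ 2 + 3 * k) * ∑ y ∈ Finset.HasAntidiagonal.antidiagonal k,
          q ^ (y.1 ^ 2 + 3 * y.1) * cubicAlpha q y.1 /
            (qPoch (q ^ 2) (q ^ 2) y.2 * qPoch (q ^ 2) (q ^ 2) (y.2 + 2 * y.1 + 3)) := by
    funext k
    have hb := bailey_base_change hq (cubicAlpha q) k
    have hk := qPoch_neg_ne_zero hq (2 * k + 3)
    rw [mul_comm, ← div_eq_iff hk] at hb
    rw [← hb, qConv, Finset.sum_div, Finset.mul_sum, ← Finset.Nat.sum_antidiagonal_swap]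
    refine Finset.sum_congr rfl fun x hx => ?_
    simp only [Prod.fst_swap, Prod.snd_swap]
    rw [cubic_bailey_pair hq hq0 hw h30, termNum, termDen,
      ← Finset.HasAntidiagonal.mem_antidiagonal.mp hx,
      show 2 * x.2 + 2 * x.1 + 3 = 2 * (x.1 + x.2) + 3 by ring]
    simp only [div_eq_mul_inv, mul_inv]
    ring
  rw [h, bailey_finite hp fun j => q ^ (j ^ 2 + 3 * j) * cubicAlpha q j]
  refine Finset.sum_congr rfl fun x _ => ?_
  rw [← pow_mul]
  ring

end FiniteIdentity

/-! ### Theta series and transfer from fields to rings -/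

section Theta

/-- The theta series summand, supported on the multiples of `3`. -/
def thetaTerm {R : Type*} [CommRing R] (q : R) (j : ℕ) : R :=
  q ^ (3 * (j ^ 2 + 3 * j)) * cubicAlpha q j

theorem thetaTerm_eq_zero {R : Type*} [CommRing R] (q : R) {j : ℕ} (hj : ¬3 ∣ j) :
    thetaTerm q j = 0 := by
  simp [thetaTerm, cubicAlpha, hj]

/-- Matches the exponents at `j = 3k` with the triple product in base `q^63`; the extra `3k` comes
from `z^(-k)` at `z = q^3`. -/
theorem theta_exponent (k : ℕ) :
    3 * ((3 * k) ^ 2 + 3 * (3 * k)) + (3 * k + 1).choose 2 + 3 * k = 63 * (k + 1).choose 2 := by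
  have h1 := Nat.add_one_mul_choose_eq (3 * k) 1
  have h2 := Nat.add_one_mul_choose_eq k 1
  simp only [Nat.choose_one_right] at h1 h2
  norm_num at h1 h2
  nlinarith

theorem finite_theta {F : Type*} [Field F] {q : F} (hq : ∀ n : ℕ, q ^ (n + 1) ≠ 1)
    (hq0 : q ≠ 0) (m : ℕ) :
    qPoch (q ^ 3) (q ^ 63) (m + 1) * qPoch (q ^ 60) (q ^ 63) m
      = qPoch (q ^ 63) (q ^ 63) (2 * m + 1) * ∑ x ∈ Finset.HasAntidiagonal.antidiagonal m,
          thetaTerm q (3 * x.1) /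
            (qPoch (q ^ 63) (q ^ 63) x.2 * qPoch (q ^ 63) (q ^ 63) (x.2 + 2 * x.1 + 1)) := by
  have h := finite_triple_product (pow_pow_succ_ne_one hq (by norm_num : 0 < 63))
    (pow_ne_zero 63 hq0) (pow_ne_zero 3 hq0) m
  rw [show q ^ 63 / q ^ 3 = q ^ 60 by field_simp] at h
  rw [h]
  congr 1
  refine Finset.sum_congr rfl fun x _ => ?_
  congr 1
  rw [thetaTerm, cubicAlpha, if_pos (dvd_mul_right 3 _), pow_mul (-1) 3, ← pow_mul q 63,
    ← theta_exponent, show ((-1 : F) ^ 3) = -1 by norm_num, pow_add _ _ (3 * x.1), pow_mul q 3 x.1]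
  have h3 : (q ^ 3) ^ x.1 ≠ 0 := pow_ne_zero _ (pow_ne_zero _ hq0)
  have h4 : (q ^ 3) ^ x.1 * (q ^ 3)⁻¹ ^ x.1 = 1 := by
    rw [inv_pow, mul_inv_cancel₀ h3]
  linear_combination (-1) ^ x.1 * q ^ (3 * ((3 * x.1) ^ 2 + 3 * (3 * x.1)) +
    (3 * x.1 + 1).choose 2) * h4

theorem map_qPoch {R S : Type*} [CommRing R] [CommRing S] (φ : R →+* S) (a q : R) (m : ℕ) :
    φ (qPoch a q m) = qPoch (φ a) (φ q) m := by
  simp [qPoch]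

theorem map_thetaTerm {R S : Type*} [CommRing R] [CommRing S] (φ : R →+* S) (q : R) (j : ℕ) :
    φ (thetaTerm q j) = thetaTerm (φ q) j := by
  simp only [thetaTerm, cubicAlpha]
  split_ifs <;> simp

theorem map_ring_inverse {R F : Type*} [CommRing R] [Field F] (φ : R →+* F) {u : R}
    (hu : IsUnit u) : φ (Ring.inverse u) = (φ u)⁻¹ := by
  obtain ⟨v, rfl⟩ := hu
  rw [Ring.inverse_unit, map_units_inv]

variable {R F : Type*} [CommRing R] [Field F]

/-- Since the denominators are units of `R`, the field identity pulls back along an injection. This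
lets `ℤ⟦X⟧` use a larger field. -/
theorem finite_theta_ring (φ : R →+* F) (hφ : Function.Injective φ) {q : R}
    (hq : ∀ n : ℕ, φ q ^ (n + 1) ≠ 1) (hq0 : φ q ≠ 0)
    (hu : ∀ m, IsUnit (qPoch (q ^ 63) (q ^ 63) m)) (m : ℕ) :
    qPoch (q ^ 3) (q ^ 63) (m + 1) * qPoch (q ^ 60) (q ^ 63) m
      = qPoch (q ^ 63) (q ^ 63) (2 * m + 1) * ∑ x ∈ Finset.HasAntidiagonal.antidiagonal m,
          thetaTerm q (3 * x.1) * (Ring.inverse (qPoch (q ^ 63) (q ^ 63) x.2) *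
            Ring.inverse (qPoch (q ^ 63) (q ^ 63) (x.2 + (2 * x.1 + 1)))) := by
  apply hφ
  simp only [map_mul, map_sum, map_ring_inverse φ (hu _), map_qPoch, map_thetaTerm, map_pow]
  rw [finite_theta hq hq0]
  simp only [div_eq_mul_inv, mul_inv, add_assoc]

theorem finite_double_sum_ring (φ : R →+* F) (hφ : Function.Injective φ) {q : R}
    (hq : ∀ n : ℕ, φ q ^ (n + 1) ≠ 1) (hq0 : φ q ≠ 0) {w : F} (hw : w ^ 2 + w + 1 = 0)
    (h3 : (3 : F) ≠ 0) (hu : ∀ m, IsUnit (qPoch (q ^ 2) (q ^ 2) m))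
    (hd : ∀ n r, IsUnit (termDen q n r)) (m : ℕ) :
    ∑ x ∈ Finset.HasAntidiagonal.antidiagonal m,
        (∑ y ∈ Finset.HasAntidiagonal.antidiagonal x.1,
          termNum q y.1 y.2 * Ring.inverse (termDen q y.1 y.2)) *
        Ring.inverse (qPoch (q ^ 2) (q ^ 2) x.2)
      = ∑ x ∈ Finset.HasAntidiagonal.antidiagonal m,
          thetaTerm q x.1 * (Ring.inverse (qPoch (q ^ 2) (q ^ 2) x.2) *
            Ring.inverse (qPoch (q ^ 2) (q ^ 2) (x.2 + (2 * x.1 + 3)))) := by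
  apply hφ
  have h := finite_double_sum hq hq0 hw h3 m
  simp only [map_mul, map_sum, map_ring_inverse φ (hu _), map_ring_inverse φ (hd _ _), map_qPoch,
    map_thetaTerm, map_pow, termNum]
  simp only [termDen, map_mul, map_qPoch, map_pow, map_neg]
  simp only [qConv, termNum, termDen, div_eq_mul_inv] at h
  rw [h]
  simp only [mul_inv, add_assoc, thetaTerm]

end Theta

/-! ### Passage to the limit -/

section Limit

variable {R : Type*} [CommRing R] [TopologicalSpace R] [IsTopologicalRing R] [T2Space R]

/-- The passage to the limit in the finite identities, in a topological ring with a class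
`Adm` of sequences for which a dominated convergence theorem holds. -/
theorem hasSum_double_series {q : R} (Adm : (ℕ → R) → Prop)
    (hT : ∀ u, Adm u → ∀ (c d : ℕ → R) (L M : R) (e : ℕ → ℕ),
      Filter.Tendsto c Filter.atTop (nhds L) → Filter.Tendsto d Filter.atTop (nhds M) →
      Filter.Tendsto (fun m => ∑ x ∈ Finset.HasAntidiagonal.antidiagonal m,
        u x.1 * (c x.2 * d (x.2 + e x.1))) Filter.atTop (nhds ((∑' j, u j) * (L * M))))
    (hP : ∀ i k, 0 < i → 0 < k → Filter.Tendsto (qPoch (q ^ i) (q ^ k)) Filter.atTop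
      (nhds (qPochInf (q ^ i) (q ^ k))))
    (hI : ∀ i, 0 < i → Filter.Tendsto (fun m => Ring.inverse (qPoch (q ^ i) (q ^ i) m))
      Filter.atTop (nhds (Ring.inverse (qPochInf (q ^ i) (q ^ i)))))
    (hU : ∀ i, 0 < i → IsUnit (qPochInf (q ^ i) (q ^ i)))
    (hfin : ∀ m, ∑ x ∈ Finset.HasAntidiagonal.antidiagonal m,
        (∑ y ∈ Finset.HasAntidiagonal.antidiagonal x.1,
          termNum q y.1 y.2 * Ring.inverse (termDen q y.1 y.2)) *
        Ring.inverse (qPoch (q ^ 2) (q ^ 2) x.2)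
      = ∑ x ∈ Finset.HasAntidiagonal.antidiagonal m,
          thetaTerm q x.1 * (Ring.inverse (qPoch (q ^ 2) (q ^ 2) x.2) *
            Ring.inverse (qPoch (q ^ 2) (q ^ 2) (x.2 + (2 * x.1 + 3)))))
    (htheta : ∀ m, qPoch (q ^ 3) (q ^ 63) (m + 1) * qPoch (q ^ 60) (q ^ 63) m
      = qPoch (q ^ 63) (q ^ 63) (2 * m + 1) * ∑ x ∈ Finset.HasAntidiagonal.antidiagonal m,
          thetaTerm q (3 * x.1) * (Ring.inverse (qPoch (q ^ 63) (q ^ 63) x.2) *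
            Ring.inverse (qPoch (q ^ 63) (q ^ 63) (x.2 + (2 * x.1 + 1)))))
    (hs : Summable fun p : ℕ × ℕ => termNum q p.1 p.2 * Ring.inverse (termDen q p.1 p.2))
    (hA : Adm fun k => ∑ y ∈ Finset.HasAntidiagonal.antidiagonal k,
          termNum q y.1 y.2 * Ring.inverse (termDen q y.1 y.2))
    (hA1 : Adm (thetaTerm q)) (hA3 : Adm fun k => thetaTerm q (3 * k)) :
    HasSum (fun p : ℕ × ℕ => termNum q p.1 p.2 * Ring.inverse (termDen q p.1 p.2))
      (qPochInf (q ^ 3) (q ^ 63) * qPochInf (q ^ 60) (q ^ 63)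
        * qPochInf (q ^ 63) (q ^ 63) * Ring.inverse (qPochInf (q ^ 2) (q ^ 2))) := by
  have e1 : ∑' j, thetaTerm q j = ∑' k, thetaTerm q (3 * k) := by
    refine ((mul_right_injective₀ (three_ne_zero (α := ℕ))).tsum_eq fun j hj => ?_).symm
    by_contra h
    exact hj (thetaTerm_eq_zero q fun ⟨k, hk⟩ => h ⟨k, hk.symm⟩)
  have e2 : HasSum (fun k => ∑ y ∈ Finset.HasAntidiagonal.antidiagonal k,
      termNum q y.1 y.2 * Ring.inverse (termDen q y.1 y.2))
      (∑' p : ℕ × ℕ, termNum q p.1 p.2 * Ring.inverse (termDen q p.1 p.2)) := by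
    have h := (Finset.HasAntidiagonal.sigmaAntidiagonalEquivProd (A := ℕ)).hasSum_iff.mpr hs.hasSum
    refine h.sigma fun k => ?_
    have h' := hasSum_fintype (fun y : Finset.HasAntidiagonal.antidiagonal k =>
      termNum q y.1.1 y.1.2 * Ring.inverse (termDen q y.1.1 y.1.2))
    rwa [Finset.sum_coe_sort (Finset.HasAntidiagonal.antidiagonal k) (fun y =>
      termNum q y.1 y.2 * Ring.inverse (termDen q y.1 y.2))] at h'
  -- The left side carries a single inverse product, so the second sequence is constantly `1`.
  have t1 := hT _ hA _ _ _ _ (fun _ => 0) (hI 2 two_pos) (tendsto_const_nhds (x := 1))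
  have t2 := hT _ hA1 _ _ _ _ (fun j => 2 * j + 3) (hI 2 two_pos) (hI 2 two_pos)
  have t3 := hT _ hA3 _ _ _ _ (fun j => 2 * j + 1) (hI 63 (by norm_num)) (hI 63 (by norm_num))
  have s1 := tendsto_nhds_unique t1 (t2.congr fun m => by rw [← hfin m]; simp only [mul_one])
  have l1 := (((Filter.tendsto_add_atTop_iff_nat 1).mpr (hP 3 63 (by norm_num) (by norm_num))).mul
    (hP 60 63 (by norm_num) (by norm_num)))
  have l2 := ((hP 63 63 (by norm_num) (by norm_num)).comp
    (Filter.tendsto_atTop_mono (fun m => (by omega : m ≤ 2 * m + 1)) Filter.tendsto_id)).mul t3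
  have s2 := tendsto_nhds_unique l1 (l2.congr fun m => (htheta m).symm)
  rw [e2.tsum_eq, e1] at s1
  have i2 := Ring.mul_inverse_cancel _ (hU 2 two_pos)
  have i63 := Ring.mul_inverse_cancel _ (hU 63 (by norm_num))
  have key : ∑' p : ℕ × ℕ, termNum q p.1 p.2 * Ring.inverse (termDen q p.1 p.2)
      = qPochInf (q ^ 3) (q ^ 63) * qPochInf (q ^ 60) (q ^ 63)
        * qPochInf (q ^ 63) (q ^ 63) * Ring.inverse (qPochInf (q ^ 2) (q ^ 2)) := by
    generalize qPochInf (q ^ 63) (q ^ 63) = Q at *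
    generalize Ring.inverse Q = Q' at *
    generalize qPochInf (q ^ 2) (q ^ 2) = P at *
    generalize Ring.inverse P = P' at *
    generalize (∑' p : ℕ × ℕ, termNum q p.1 p.2 * Ring.inverse (termDen q p.1 p.2)) = S at *
    generalize (∑' k, thetaTerm q (3 * k)) = T at *
    rw [s2]
    linear_combination P * s1 - S * i2 + T * P' * i2 - T * P' * (Q * Q' + 1) * i63
  rw [← key]
  exact hs.hasSum

end Limit

/-! ### Complex case: dominated convergence -/

section Complex

theorem tendsto_sum_antidiagonal_complex {u : ℕ → ℂ} (hu : Summable fun j => ‖u j‖)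
    (c d : ℕ → ℂ) (L M : ℂ) (e : ℕ → ℕ) (hc : Filter.Tendsto c Filter.atTop (nhds L))
    (hd : Filter.Tendsto d Filter.atTop (nhds M)) :
    Filter.Tendsto (fun m => ∑ x ∈ Finset.HasAntidiagonal.antidiagonal m,
      u x.1 * (c x.2 * d (x.2 + e x.1))) Filter.atTop (nhds ((∑' j, u j) * (L * M))) := by
  obtain ⟨B, hB⟩ := hc.norm.bddAbove_range
  obtain ⟨C, hC⟩ := hd.norm.bddAbove_range
  replace hB : ∀ n, ‖c n‖ ≤ B := fun n => hB ⟨n, rfl⟩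
  replace hC : ∀ n, ‖d n‖ ≤ C := fun n => hC ⟨n, rfl⟩
  have hB0 : 0 ≤ B := (norm_nonneg _).trans (hB 0)
  have hC0 : 0 ≤ C := (norm_nonneg _).trans (hC 0)
  have h := tendsto_tsum_of_dominated_convergence (𝓕 := Filter.atTop)
    (f := fun m j => if j ∈ Finset.range (m + 1) then u j * (c (m - j) * d (m - j + e j)) else 0)
    (g := fun j => u j * (L * M)) (bound := fun j => ‖u j‖ * (B * C)) (hu.mul_right _) ?_ ?_
  · rw [tsum_mul_right] at h
    refine h.congr fun m => ?_
    rw [Finset.Nat.sum_antidiagonal_eq_sum_range_succ (fun j t => u j * (c t * d (t + e j))),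
      tsum_eq_sum (s := Finset.range (m + 1)) fun j hj => if_neg hj]
    exact Finset.sum_congr rfl fun j hj => if_pos hj
  · intro j
    have h1 := (hc.comp (Filter.tendsto_sub_atTop_nat j)).mul
      (hd.comp ((Filter.tendsto_add_atTop_nat (e j)).comp (Filter.tendsto_sub_atTop_nat j)))
    refine (h1.const_mul (u j)).congr' ?_
    filter_upwards [Filter.eventually_ge_atTop j] with m hm
    rw [if_pos (Finset.mem_range.mpr (by omega))]
    rfl
  · refine Filter.Eventually.of_forall fun m j => ?_
    split_ifs
    · rw [norm_mul, norm_mul]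
      exact mul_le_mul_of_nonneg_left (mul_le_mul (hB _) (hC _) (norm_nonneg _) hB0)
        (norm_nonneg _)
    · rw [norm_zero]
      positivity

theorem tendsto_qPoch_complex (a : ℂ) {q : ℂ} (hq : ‖q‖ < 1) :
    Filter.Tendsto (qPoch a q) Filter.atTop (nhds (qPochInf a q)) :=
  (multipliable_qPochInf_complex a hq).hasProd.tendsto_prod_nat

theorem one_sub_mul_pow_ne_zero {a q : ℂ} (ha : ‖a‖ < 1) (hq : ‖q‖ < 1) (j : ℕ) :
    1 - a * q ^ j ≠ 0 := by
  intro h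
  have h1 : ‖a * q ^ j‖ < 1 := by
    rw [norm_mul, norm_pow]
    exact (mul_le_of_le_one_right (norm_nonneg a) (pow_le_one₀ (norm_nonneg q) hq.le)).trans_lt ha
  rw [← sub_eq_zero.mp h, norm_one] at h1
  exact lt_irrefl _ h1

theorem qPochInf_ne_zero {a q : ℂ} (ha : ‖a‖ < 1) (hq : ‖q‖ < 1) : qPochInf a q ≠ 0 := by
  have h : ∏' j : ℕ, (1 + -(a * q ^ j)) ≠ 0 := by
    refine tprod_one_add_ne_zero_of_summable (fun j => ?_) ?_
    · simpa [sub_eq_add_neg] using one_sub_mul_pow_ne_zero ha hq j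
    · simp only [norm_neg, norm_mul, norm_pow]
      exact (summable_geometric_of_lt_one (norm_nonneg q) hq).mul_left _
  simpa [qPochInf, sub_eq_add_neg] using h

theorem tendsto_qPoch_inv {a q : ℂ} (ha : ‖a‖ < 1) (hq : ‖q‖ < 1) :
    Filter.Tendsto (fun m => (qPoch a q m)⁻¹) Filter.atTop (nhds (qPochInf a q)⁻¹) :=
  (tendsto_qPoch_complex a hq).inv₀ (qPochInf_ne_zero ha hq)

theorem exists_norm_le_of_tendsto {c : ℕ → ℂ} {L : ℂ}
    (hc : Filter.Tendsto c Filter.atTop (nhds L)) : ∃ B, 0 ≤ B ∧ ∀ n, ‖c n‖ ≤ B := by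
  obtain ⟨B, hB⟩ := hc.norm.bddAbove_range
  exact ⟨B, (norm_nonneg _).trans (hB ⟨0, rfl⟩), fun n => hB ⟨n, rfl⟩⟩

/-- The Pochhammer factors and their inverses converge, hence are bounded, and the exponent is at
least `n + r`: a product of geometric series dominates. -/
theorem summable_norm_term {q : ℂ} (hq : ‖q‖ < 1) :
    Summable fun p : ℕ × ℕ => ‖termNum q p.1 p.2 * (termDen q p.1 p.2)⁻¹‖ := by
  have hp : ∀ i, 0 < i → ‖q ^ i‖ < 1 := fun i hi => by
    rw [norm_pow]
    exact pow_lt_one₀ (norm_nonneg q) hq hi.ne'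
  obtain ⟨A, hA0, hA⟩ := exists_norm_le_of_tendsto
    (tendsto_qPoch_complex (q ^ 3) (hp 3 (by norm_num)))
  obtain ⟨B, hB0, hB⟩ := exists_norm_le_of_tendsto
    (tendsto_qPoch_inv (a := -q) (by simpa using hq) hq)
  obtain ⟨C, hC0, hC⟩ := exists_norm_le_of_tendsto (tendsto_qPoch_inv hq hq)
  obtain ⟨D, hD0, hD⟩ := exists_norm_le_of_tendsto
    (tendsto_qPoch_inv (hp 2 two_pos) (hp 2 two_pos))
  have hg := summable_geometric_of_lt_one (norm_nonneg q) hq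
  have hgg := (hg.mul_of_nonneg hg (fun _ => by positivity) (fun _ => by positivity)).mul_right
    (A * (B * C * C * D))
  refine Summable.of_nonneg_of_le (fun _ => norm_nonneg _) (fun p => ?_) hgg
  obtain ⟨n, r⟩ := p
  rw [termNum, termDen, mul_inv, mul_inv, mul_inv]
  simp only [norm_mul, norm_pow, mul_assoc]
  rw [← mul_assoc (‖q‖ ^ n), ← pow_add]
  have h1 : ‖q‖ ^ (2 * n ^ 2 + 4 * n * r + 3 * r ^ 2 + 6 * n + 9 * r) ≤ ‖q‖ ^ (n + r) :=
    pow_le_pow_of_le_one (norm_nonneg q) hq.le (by nlinarith [Nat.zero_le (n * r)])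
  simp only [mul_assoc] at h1
  gcongr
  · exact hA _
  · exact hB _
  · exact hC _
  · exact hC _
  · exact hD _

theorem summable_norm_thetaTerm {q : ℂ} (hq : ‖q‖ < 1) : Summable fun j => ‖thetaTerm q j‖ := by
  refine Summable.of_nonneg_of_le (fun _ => norm_nonneg _) (fun j => ?_)
    ((summable_geometric_of_lt_one (norm_nonneg q) hq).mul_right 2)
  have h1 : ‖cubicAlpha q j‖ ≤ 2 := by
    rw [cubicAlpha]
    split_ifs
    · rw [norm_mul, norm_mul, norm_pow, norm_neg, norm_one, one_pow, one_mul, norm_pow]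
      have h2 : ‖q‖ ^ ((j + 1).choose 2) ≤ 1 := pow_le_one₀ (norm_nonneg q) hq.le
      have h3 : ‖1 - q ^ (2 * j + 3)‖ ≤ 2 := by
        refine (norm_sub_le _ _).trans ?_
        rw [norm_one, norm_pow]
        linarith [pow_le_one₀ (n := 2 * j + 3) (norm_nonneg q) hq.le]
      calc _ ≤ 1 * (2 : ℝ) := mul_le_mul h2 h3 (norm_nonneg _) zero_le_one
        _ = 2 := one_mul 2
    · simp
  rw [thetaTerm, norm_mul, norm_pow]
  refine mul_le_mul ?_ h1 (norm_nonneg _) (by positivity)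
  exact pow_le_pow_of_le_one (norm_nonneg q) hq.le (by nlinarith)

theorem hasSum_double_series_zero :
    HasSum (fun p : ℕ × ℕ => termNum (0 : ℂ) p.1 p.2 / termDen 0 p.1 p.2)
      (qPochInf (0 ^ 3) (0 ^ 63) * qPochInf (0 ^ 60) (0 ^ 63) * qPochInf (0 ^ 63) (0 ^ 63)
          / qPochInf (0 ^ 2) (0 ^ 2)) := by
  have h1 : ∀ m, qPoch (0 : ℂ) 0 m = 1 := fun m => by simp [qPoch]
  have h2 : qPochInf (0 : ℂ) 0 = 1 := by simp [qPochInf]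
  have h := hasSum_single (f := fun p : ℕ × ℕ => termNum (0 : ℂ) p.1 p.2 / termDen 0 p.1 p.2)
    (0, 0) fun p hp => by
      have : 2 * p.1 ^ 2 + 4 * p.1 * p.2 + 3 * p.2 ^ 2 + 6 * p.1 + 9 * p.2 ≠ 0 := by
        intro h0
        exact hp (Prod.ext (by dsimp only; omega) (by dsimp only; omega))
      simp only [termNum, zero_pow this, zero_mul, zero_div]
  simpa [termNum, termDen, h1, h2] using h

theorem exists_sq_add_self_add_one_eq_zero : ∃ w : ℂ, w ^ 2 + w + 1 = 0 := by
  obtain ⟨w, hw⟩ := IsAlgClosed.exists_pow_nat_eq (-3 : ℂ) two_pos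
  exact ⟨(w - 1) / 2, by linear_combination hw / 4⟩

theorem hasSum_double_series_complex {q : ℂ} (hq : ‖q‖ < 1) :
    HasSum (fun p : ℕ × ℕ => termNum q p.1 p.2 / termDen q p.1 p.2)
      (qPochInf (q ^ 3) (q ^ 63) * qPochInf (q ^ 60) (q ^ 63) * qPochInf (q ^ 63) (q ^ 63)
          / qPochInf (q ^ 2) (q ^ 2)) := by
  -- The triple product is used at `z = ζ/q`, so `q = 0` is separate; there only the term `(0, 0)`
  -- survives.
  rcases eq_or_ne q 0 with rfl | hq0
  · exact hasSum_double_series_zero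
  have hp : ∀ i, 0 < i → ‖q ^ i‖ < 1 := fun i hi => by
    rw [norm_pow]
    exact pow_lt_one₀ (norm_nonneg q) hq hi.ne'
  have hq1 : ∀ n : ℕ, q ^ (n + 1) ≠ 1 := fun n h => by
    have := hp (n + 1) n.succ_pos
    rw [h, norm_one] at this
    exact lt_irrefl _ this
  obtain ⟨w, hw⟩ := exists_sq_add_self_add_one_eq_zero
  have hu : ∀ i, 0 < i → ∀ m, IsUnit (qPoch (q ^ i) (q ^ i) m) := fun i hi m =>
    (qPoch_self_ne_zero (pow_pow_succ_ne_one hq1 hi) m).isUnit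
  have hn := summable_norm_term hq
  have ht := summable_norm_thetaTerm hq
  have h := hasSum_double_series (q := q) (fun u => Summable fun j => ‖u j‖)
    (fun u hu => tendsto_sum_antidiagonal_complex hu)
    (fun i k _ hk => tendsto_qPoch_complex _ (hp k hk))
    (fun i hi => by
      simp only [Ring.inverse_eq_inv']
      exact tendsto_qPoch_inv (hp i hi) (hp i hi))
    (fun i hi => (qPochInf_ne_zero (hp i hi) (hp i hi)).isUnit)
    (finite_double_sum_ring (RingHom.id ℂ) Function.injective_id hq1 hq0 hw (by norm_num)
      (hu 2 two_pos) fun n r => (termDen_ne_zero hq n r).isUnit)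
    (finite_theta_ring (RingHom.id ℂ) Function.injective_id hq1 hq0 (hu 63 (by norm_num)))
    (by simpa only [Ring.inverse_eq_inv'] using hn.of_norm)
    (by
      simp only [Ring.inverse_eq_inv']
      have h1 := (Finset.HasAntidiagonal.sigmaAntidiagonalEquivProd (A := ℕ)).summable_iff.mpr hn
      refine Summable.of_nonneg_of_le (fun _ => norm_nonneg _) (fun k => ?_) h1.sigma
      rw [tsum_fintype]
      exact (norm_sum_le _ _).trans_eq (Finset.sum_coe_sort
        (Finset.HasAntidiagonal.antidiagonal k) fun y =>
          ‖termNum q y.1 y.2 * (termDen q y.1 y.2)⁻¹‖).symm)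
    ht (ht.comp_injective (mul_right_injective₀ (three_ne_zero (α := ℕ))))
  simpa only [Ring.inverse_eq_inv', div_eq_mul_inv] using h

end Complex

/-! ### Formal case: congruences modulo powers of `X` -/

section Formal

theorem tendsto_iff_eventually_X_pow_dvd {ι : Type*} {l : Filter ι} {f : ι → PowerSeries ℤ}
    {g : PowerSeries ℤ} :
    Filter.Tendsto f l (nhds g) ↔ ∀ K : ℕ, ∀ᶠ i in l, PowerSeries.X ^ K ∣ f i - g := by
  simp only [PowerSeries.WithPiTopology.tendsto_iff_coeff_tendsto, nhds_discrete,
    Filter.tendsto_pure, PowerSeries.X_pow_dvd_iff, map_sub, sub_eq_zero]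
  refine ⟨fun h K => (Set.finite_lt_nat K).eventually_all.mpr fun d _ => h d, fun h d => ?_⟩
  filter_upwards [h (d + 1)] with i hi using hi d d.lt_succ_self

theorem summable_of_eventually_X_pow_dvd {u : ℕ → PowerSeries ℤ}
    (hu : ∀ K : ℕ, ∀ᶠ j in Filter.atTop, PowerSeries.X ^ K ∣ u j) : Summable u := by
  rw [PowerSeries.WithPiTopology.summable_iff_summable_coeff]
  intro d
  obtain ⟨J, hJ⟩ := Filter.eventually_atTop.mp (hu (d + 1))
  refine summable_of_ne_finset_zero (s := Finset.range J) fun j hj => ?_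
  exact PowerSeries.X_pow_dvd_iff.mp (hJ j (by simpa using hj)) d d.lt_succ_self

theorem tendsto_sum_antidiagonal_formal {u : ℕ → PowerSeries ℤ}
    (hu : ∀ K : ℕ, ∀ᶠ j in Filter.atTop, PowerSeries.X ^ K ∣ u j)
    (c d : ℕ → PowerSeries ℤ) (L M : PowerSeries ℤ) (e : ℕ → ℕ)
    (hc : Filter.Tendsto c Filter.atTop (nhds L)) (hd : Filter.Tendsto d Filter.atTop (nhds M)) :
    Filter.Tendsto (fun m => ∑ x ∈ Finset.HasAntidiagonal.antidiagonal m,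
      u x.1 * (c x.2 * d (x.2 + e x.1))) Filter.atTop (nhds ((∑' j, u j) * (L * M))) := by
  rw [tendsto_iff_eventually_X_pow_dvd]
  intro K
  obtain ⟨J, hJ⟩ := Filter.eventually_atTop.mp (hu K)
  have hsum := (summable_of_eventually_X_pow_dvd hu).hasSum.tendsto_sum_nat
  obtain ⟨N, hN⟩ := Filter.eventually_atTop.mp (tendsto_iff_eventually_X_pow_dvd.mp hsum K)
  -- Cut at `J + N`: beyond `J` every `u j` vanishes modulo `X^K`, and beyond `N` the partial sums
  -- agree with the total modulo `X^K`.
  have h1 : Filter.Tendsto (fun m => ∑ j ∈ Finset.range (J + N),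
      u j * (c (m - j) * d (m - j + e j))) Filter.atTop
      (nhds (∑ j ∈ Finset.range (J + N), u j * (L * M))) := by
    refine tendsto_finsetSum _ fun j _ => Filter.Tendsto.const_mul _ ?_
    exact (hc.comp (Filter.tendsto_sub_atTop_nat j)).mul
      (hd.comp ((Filter.tendsto_add_atTop_nat (e j)).comp (Filter.tendsto_sub_atTop_nat j)))
  filter_upwards [tendsto_iff_eventually_X_pow_dvd.mp h1 K,
    Filter.eventually_ge_atTop (J + N)] with m hm hmJ
  rw [Finset.Nat.sum_antidiagonal_eq_sum_range_succ (fun j t => u j * (c t * d (t + e j))),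
    ← Finset.sum_range_add_sum_Ico _ (hmJ.trans m.le_succ)]
  have h2 : PowerSeries.X ^ K ∣ ∑ j ∈ Finset.Ico (J + N) m.succ,
      u j * (c (m - j) * d (m - j + e j)) :=
    Finset.dvd_sum fun j hj => Dvd.dvd.mul_right
      (hJ j (by have := (Finset.mem_Ico.mp hj).1; omega)) _
  have h3 := (hN (J + N) (by omega)).mul_right (L * M)
  rw [sub_mul, Finset.sum_mul] at h3
  have h4 := (hm.add h2).add h3
  convert h4 using 1
  ring

theorem tendsto_ring_inverse {c : ℕ → PowerSeries ℤ} {L : PowerSeries ℤ}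
    (hc : Filter.Tendsto c Filter.atTop (nhds L)) (hu : ∀ n, IsUnit (c n)) (hL : IsUnit L) :
    Filter.Tendsto (fun n => Ring.inverse (c n)) Filter.atTop (nhds (Ring.inverse L)) := by
  rw [tendsto_iff_eventually_X_pow_dvd] at hc ⊢
  intro K
  filter_upwards [hc K] with n hn
  have h1 := Ring.mul_inverse_cancel _ (hu n)
  have h2 := Ring.mul_inverse_cancel _ hL
  have h3 : Ring.inverse (c n) - Ring.inverse L
      = (c n - L) * -(Ring.inverse (c n) * Ring.inverse L) := by
    linear_combination Ring.inverse L * h1 - Ring.inverse (c n) * h2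
  rw [h3]
  exact hn.mul_right _

theorem tendsto_qPoch_formal (i : ℕ) {k : ℕ} (hk : 0 < k) :
    Filter.Tendsto (qPoch (qvar ^ i) (qvar ^ k)) Filter.atTop
      (nhds (qPochInf (qvar ^ i) (qvar ^ k))) :=
  (multipliable_qPochInf_formal i hk).hasProd.tendsto_prod_nat

theorem isUnit_qPoch_formal {i : ℕ} (hi : 0 < i) (m : ℕ) :
    IsUnit (qPoch (qvar ^ i) (qvar ^ i) m) := by
  rw [PowerSeries.isUnit_iff_constantCoeff]
  simp [qPoch, map_prod, hi.ne']

theorem isUnit_qPochInf_self_formal {i : ℕ} (hi : 0 < i) :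
    IsUnit (qPochInf (qvar ^ i) (qvar ^ i)) := by
  rw [PowerSeries.isUnit_iff_constantCoeff, qPochInf,
    (multipliable_qPochInf_formal i hi).map_tprod _
      (PowerSeries.WithPiTopology.continuous_constantCoeff ℤ)]
  simp [hi.ne']

theorem X_pow_dvd_term {K n r : ℕ} (h : K ≤ n + r) :
    PowerSeries.X ^ K ∣ termNum qvar n r * Ring.inverse (termDen qvar n r) := by
  rw [termNum, mul_assoc]
  exact Dvd.dvd.mul_right (pow_dvd_pow _ (by nlinarith [Nat.zero_le (n * r)])) _

theorem summable_term_formal : Summable fun p : ℕ × ℕ =>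
    termNum qvar p.1 p.2 * Ring.inverse (termDen qvar p.1 p.2) := by
  rw [PowerSeries.WithPiTopology.summable_iff_summable_coeff]
  intro d
  refine summable_of_ne_finset_zero (s := Finset.range (d + 1) ×ˢ Finset.range (d + 1))
    fun p hp => ?_
  refine PowerSeries.X_pow_dvd_iff.mp (X_pow_dvd_term (K := d + 1) ?_) d d.lt_succ_self
  simp only [Finset.mem_product, Finset.mem_range] at hp
  omega

theorem X_pow_dvd_thetaTerm {K j : ℕ} (h : K ≤ j) : PowerSeries.X ^ K ∣ thetaTerm qvar j :=
  Dvd.dvd.mul_right (pow_dvd_pow _ (by nlinarith)) _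

theorem hasSum_double_series_formal :
    HasSum (fun p : ℕ × ℕ => termNum qvar p.1 p.2 * Ring.inverse (termDen qvar p.1 p.2))
      (qPochInf (qvar ^ 3) (qvar ^ 63) * qPochInf (qvar ^ 60) (qvar ^ 63)
        * qPochInf (qvar ^ 63) (qvar ^ 63) * Ring.inverse (qPochInf (qvar ^ 2) (qvar ^ 2))) := by
  -- The finite identity needs a field with a primitive cube root of unity, hence complex
  -- coefficients.
  let φ : PowerSeries ℤ →+* FractionRing (PowerSeries ℂ) :=
    (algebraMap (PowerSeries ℂ) (FractionRing (PowerSeries ℂ))).comp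
      (PowerSeries.map (Int.castRingHom ℂ))
  have hφ : Function.Injective φ := fun a b h =>
    PowerSeries.map_injective (Int.castRingHom ℂ) (RingHom.injective_int _)
      (IsFractionRing.injective (PowerSeries ℂ) (FractionRing (PowerSeries ℂ)) h)
  obtain ⟨w, hw⟩ := exists_sq_add_self_add_one_eq_zero
  let ψ : ℂ →+* FractionRing (PowerSeries ℂ) :=
    (algebraMap (PowerSeries ℂ) (FractionRing (PowerSeries ℂ))).comp (PowerSeries.C (R := ℂ))
  have hw' : ψ w ^ 2 + ψ w + 1 = 0 := by
    rw [← map_pow, ← map_add, ← map_one ψ, ← map_add, hw, map_zero]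
  have h3 : (3 : FractionRing (PowerSeries ℂ)) ≠ 0 := by
    rw [← map_ofNat ψ 3]
    exact (map_ne_zero ψ).mpr (by norm_num)
  have hq0 : φ qvar ≠ 0 := (map_ne_zero_iff φ hφ).mpr PowerSeries.X_ne_zero
  have hq1 : ∀ n : ℕ, φ qvar ^ (n + 1) ≠ 1 := fun n h => by
    rw [← map_pow, ← map_one φ] at h
    have := congrArg (PowerSeries.constantCoeff (R := ℤ)) (hφ h)
    simp at this
  exact hasSum_double_series (q := qvar)
    (fun u => ∀ K : ℕ, ∀ᶠ j in Filter.atTop, PowerSeries.X ^ K ∣ u j)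
    (fun u hu => tendsto_sum_antidiagonal_formal hu)
    (fun i k _ hk => tendsto_qPoch_formal i hk)
    (fun i hi => tendsto_ring_inverse (tendsto_qPoch_formal i hi) (isUnit_qPoch_formal hi)
      (isUnit_qPochInf_self_formal hi))
    (fun i hi => isUnit_qPochInf_self_formal hi)
    (finite_double_sum_ring φ hφ hq1 hq0 hw' h3 (isUnit_qPoch_formal two_pos) isUnit_termDen)
    (finite_theta_ring φ hφ hq1 hq0 (isUnit_qPoch_formal (by norm_num)))
    summable_term_formal
    (fun K => by
      filter_upwards [Filter.eventually_ge_atTop K] with k hk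
      exact Finset.dvd_sum fun y hy => X_pow_dvd_term
        (hk.trans_eq (Finset.HasAntidiagonal.mem_antidiagonal.mp hy).symm))
    (fun K => by
      filter_upwards [Filter.eventually_ge_atTop K] with k hk using X_pow_dvd_thetaTerm hk)
    (fun K => by
      filter_upwards [Filter.eventually_ge_atTop K] with k hk
      exact X_pow_dvd_thetaTerm (by omega))

end Formal

theorem mainTheorem8 :
    -- the identity of analytic functions on the open unit disc
    (∀ q : ℂ, ‖q‖ < 1 →
      HasSum (fun p : ℕ × ℕ => termNum q p.1 p.2 / termDen q p.1 p.2)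
        (qPochInf (q ^ 3) (q ^ 63) * qPochInf (q ^ 60) (q ^ 63) * qPochInf (q ^ 63) (q ^ 63)
          / qPochInf (q ^ 2) (q ^ 2))) ∧
    -- the identity of formal power series with integer coefficients in the variable `q = qvar`
    HasSum (fun p : ℕ × ℕ => termNum qvar p.1 p.2 * Ring.inverse (termDen qvar p.1 p.2))
      (qPochInf (qvar ^ 3) (qvar ^ 63) * qPochInf (qvar ^ 60) (qvar ^ 63)
        * qPochInf (qvar ^ 63) (qvar ^ 63) * Ring.inverse (qPochInf (qvar ^ 2) (qvar ^ 2))) :=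
  ⟨fun _ hq => hasSum_double_series_complex hq, hasSum_double_series_formal⟩
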